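/- Let $G$ be a finitely generated group with infinitely many ends. A Stallings--Dunwoody decomposition of $G$ is an action of $G$ on a simplicial tree $T$, by automorphisms and without inversions, with finitely many orbits of vertices and edges, with finite edge stabilisers, and such that every vertex stabiliser is either finite or (finitely generated and) one-ended; equivalently, it is a splitting of $G$ as a finite graph of groups with finite edge groups whose vertex groups have at most one end. Assume that $G$ is accessible, i.e. that it has such a decomposition. Suppose that $T$ is a Stallings--Dunwoody decomposition of $G$ such that for each vertex $v$ of $T$ with one-ended stabiliser $G_v$ there is a finite-index normal subgroup $K_v \trianglelefteq G_v$ with $K_v \cap G_e = 1$ for every edge $e$ of $T$ incident to $v$. Then $G$ has a finite-index subgroup $K$ that is a free product $$K = H_1 * \cdots * H_m * F$$ of finitely many one-ended groups $H_1,\dots,H_m$ and a finitely generated free group $F$ (where $m=0$ and $F=1$ are allowed). Furthermore, for every automorphism $\Phi$ of $G$ there is an integer $k \ge 1$ such that $\Phi^k(K)=K$ and, writing $\Psi = \Phi^k|_K \in \operatorname{Aut}(K)$, the suspension $K_\Psi = K \rtimes_\Psi \mathbb{Z}$ is a finite-index subgroup of the suspension $G_\Phi = G \rtimes_\Phi \mathbb{Z}$: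 the inclusion $K \hookrightarrow G$ together with $s \mapsto t^k$, where $s$ and $t$ are the stable letters of $K_\Psi$ and $G_\Phi$, extends to an injective homomorphism $K_\Psi \to G_\Phi$ with image of finite index. -/

import Mathlib

universe u v

/-- The number of ends of the Cayley graph of `G` with respect to the set `S`. -/
noncomputable def cayleyNumEnds {G : Type u} [Group G] (S : Set G) : ℕ∞ :=
  (SimpleGraph.mulCayley S).end.encard

/-- A finitely generated group with exactly one end (the number of ends of the Cayley graph does
not depend on the chosen finite generating set). -/
def IsOneEnded (G : Type u) [Group G] : Prop :=
  ∃ S : Finset G, Subgroup.closure (S : Set G) = ⊤ ∧ cayleyNumEnds (S : Set G) = 1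

/-- A finitely generated group with infinitely many ends. -/
def IsInfinitelyEnded (G : Type u) [Group G] : Prop :=
  ∃ S : Finset G, Subgroup.closure (S : Set G) = ⊤ ∧ cayleyNumEnds (S : Set G) = ⊤

/-- The simplicial tree `T`, with its action of `G`, is a Stallings–Dunwoody decomposition of `G`:
`G` acts on `T` by automorphisms, without inversions and with finitely many orbits of vertices and
edges (so that the quotient is a finite graph of groups), edge groups are finite, and every vertex
group is finite or one-ended. The vertex group of `v` is its stabiliser, and the edge group of the
edge joining `v` and `w` is the intersection of their stabilisers. -/
structure IsStallingsDunwoody (G : Type u) [Group G] {V : Type v} [MulAction G V]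
    (T : SimpleGraph V) : Prop where
  isTree : T.IsTree
  smul_adj : ∀ (g : G) (v w : V), T.Adj v w → T.Adj (g • v) (g • w)
  no_inversion : ∀ (g : G) (v w : V), T.Adj v w → ¬ (g • v = w ∧ g • w = v)
  finite_vertex_orbits : ∃ F : Set V, F.Finite ∧ ∀ v : V, ∃ g : G, g • v ∈ F
  finite_edge_orbits : ∃ F : Set (V × V), F.Finite ∧
    ∀ v w : V, T.Adj v w → ∃ g : G, (g • v, g • w) ∈ F
  finite_edge_group : ∀ v w : V, T.Adj v w →
    Finite (MulAction.stabilizer G v ⊓ MulAction.stabilizer G w : Subgroup G)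
  vertex_group : ∀ v : V,
    Finite (MulAction.stabilizer G v) ∨ IsOneEnded (MulAction.stabilizer G v)

/-- A group is accessible if it has a Stallings–Dunwoody decomposition. -/
def IsAccessible (G : Type u) [Group G] : Prop :=
  ∃ (V : Type u) (_ : MulAction G V) (T : SimpleGraph V), IsStallingsDunwoody G T

/-- `K` is the (internal) free product `H₁ * ⋯ * Hₘ * F` of finitely many one-ended subgroups `Hᵢ`
and a free group `F` of finite rank `r`; `m` and `r` may be zero. -/
def IsFreeProductOneEndedFree (K : Type u) [Group K] : Prop :=
  ∃ (m r : ℕ) (H : Fin m → Subgroup K) (f : FreeGroup (Fin r) →* K),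
    (∀ i, IsOneEnded (H i)) ∧
    Function.Bijective
      (Monoid.Coprod.lift (Monoid.CoprodI.lift fun i => (H i).subtype) f)

/-- The suspension `G ⋊_Φ ℤ`, in which the generator of `ℤ` acts on `G` as `Φ`. -/
abbrev Suspension {G : Type u} [Group G] (Φ : MulAut G) : Type u :=
  SemidirectProduct G (Multiplicative ℤ) (zpowersHom (MulAut G) Φ)

/-- The stable letter `t` of the suspension, for which `t g t⁻¹ = Φ g`. -/
def Suspension.t {G : Type u} [Group G] (Φ : MulAut G) : Suspension Φ :=
  SemidirectProduct.inr (Multiplicative.ofAdd 1)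

/-!
Homomorphisms out of a group acting on `T` are built by one principle: a choice of homomorphisms on
the stabilisers of representatives of the vertex orbits determines a 1-cocycle on the set of
vertices. If the two cocycles which it induces on the oriented edges are cohomologous, then, `T`
being a tree, the coboundary can be summed along paths, and this turns the cocycle into a
homomorphism on the whole group.

For the subgroup `K`, let `N_q` be the given normal subgroup of the vertex group `G_q` when `G_q` is
one-ended, and the trivial subgroup when `G_q` is finite. All `G_q` act on the finite set
`∏ q, G_q ⧸ N_q`. An edge group acts freely through either of its endpoints, and two free actions of
a group on the same finite set are conjugate, so the actions of the vertex groups extend to a finite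
permutation representation of `G`. Its kernel `K` meets the edge groups and the finite vertex groups
trivially.

Since `K` acts on `T` with trivial edge stabilisers, it is the free product of its nontrivial
vertex groups and of a free group on the edges outside a maximal tree of the quotient: the inverse
of the natural map out of the free product is given by the same principle. The nontrivial vertex
groups have finite index in one-ended vertex groups of `G`, and one-endedness passes to them because
it says that every almost invariant subset is finite or cofinite.

Finally `Φ` permutes the finitely many homomorphisms from `G` to the permutations of `G ⧸ K`, hence
some power of `Φ` fixes the action on `G ⧸ K`, and with it the stabiliser `K` of the trivial coset.
-/

section Cocycles

open MulAction

/-- A choice of a representative `rep q` of every orbit `q` of a `G`-set and, for every point `y`,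
of a group element `lift y` carrying the representative of its orbit to `y`. -/
structure OrbitSection (G Y : Type*) [Group G] [MulAction G Y] where
  rep : orbitRel.Quotient G Y → Y
  lift : Y → G
  lift_smul_rep (y : Y) : lift y • rep (Quotient.mk'' y) = y
  lift_rep (q : orbitRel.Quotient G Y) : lift (rep q) = 1

/-- A `P`-valued 1-cocycle on the action groupoid of the `G`-set `Y`; the value `σ g y` belongs to
the arrow from `y` to `g • y`. -/
def IsCocycle {G Y P : Type*} [Group G] [MulAction G Y] [Group P] (σ : G → Y → P) : Prop :=
  ∀ g h y, σ (g * h) y = σ g (h • y) * σ h y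

variable {G Y P : Type*} [Group G] [MulAction G Y] [Group P]

theorem orbitRel_mk_smul (g : G) (y : Y) :
    (Quotient.mk'' (g • y) : orbitRel.Quotient G Y) = Quotient.mk'' y :=
  Quotient.sound' ⟨g, rfl⟩

theorem exists_smul_eq_of_orbitRel_mk_eq {y z : Y}
    (h : (Quotient.mk'' y : orbitRel.Quotient G Y) = Quotient.mk'' z) : ∃ g : G, g • z = y :=
  Quotient.exact' h

theorem exists_orbitSection {A : Set Y}
    (hA : A.InjOn (Quotient.mk'' : Y → orbitRel.Quotient G Y)) :
    ∃ S : OrbitSection G Y, ∀ a ∈ A, S.rep (Quotient.mk'' a) = a := by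
  have hrep : ∀ q : orbitRel.Quotient G Y, ∃ y, Quotient.mk'' y = q ∧
      ∀ a ∈ A, Quotient.mk'' a = q → y = a := by
    intro q
    by_cases h : ∃ a ∈ A, Quotient.mk'' a = q
    · obtain ⟨a, ha, rfl⟩ := h
      exact ⟨a, rfl, fun b hb hba => hA ha hb hba.symm⟩
    · obtain ⟨y, rfl⟩ := Quotient.mk''_surjective q
      exact ⟨y, rfl, fun a ha haq => (h ⟨a, ha, haq⟩).elim⟩
  choose rep mk_rep rep_eq using hrep
  have hlift : ∀ y : Y, ∃ g : G, g • rep (Quotient.mk'' y) = y ∧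
      (rep (Quotient.mk'' y) = y → g = 1) := by
    intro y
    by_cases h : rep (Quotient.mk'' y) = y
    · exact ⟨1, by rw [one_smul, h], fun _ => rfl⟩
    · obtain ⟨g, hg⟩ := exists_smul_eq_of_orbitRel_mk_eq (mk_rep (Quotient.mk'' y)).symm
      exact ⟨g, hg, fun h' => (h h').elim⟩
  choose lift lift_smul lift_eq using hlift
  exact ⟨⟨rep, lift, lift_smul, fun q => lift_eq _ (by rw [mk_rep])⟩,
    fun a ha => rep_eq _ a ha rfl⟩

namespace OrbitSection

variable (S : OrbitSection G Y)

theorem mk_rep (q : orbitRel.Quotient G Y) : Quotient.mk'' (S.rep q) = q := by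
  obtain ⟨y, rfl⟩ := Quotient.mk''_surjective q
  rw [← orbitRel_mk_smul (S.lift y), S.lift_smul_rep]

theorem rep_mk_smul (g : G) (y : Y) : S.rep (Quotient.mk'' (g • y)) = S.rep (Quotient.mk'' y) := by
  rw [orbitRel_mk_smul]

theorem lift_inv_smul (y : Y) : (S.lift y)⁻¹ • y = S.rep (Quotient.mk'' y) := by
  rw [inv_smul_eq_iff, S.lift_smul_rep]

/-- The element of the stabiliser of the representative of the orbit of `y` that measures how far
`lift` is from commuting with `g` at `y`. -/
def transition (g : G) (y : Y) : stabilizer G (S.rep (Quotient.mk'' y)) :=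
  ⟨(S.lift (g • y))⁻¹ * g * S.lift y, by
    rw [mem_stabilizer_iff, mul_smul, mul_smul, S.lift_smul_rep, S.lift_inv_smul, S.rep_mk_smul]⟩

theorem lift_smul_mul_transition (g : G) (y : Y) :
    S.lift (g • y) * S.transition g y = g * S.lift y := by
  simp only [transition, mul_assoc, mul_inv_cancel_left]

theorem coe_transition_of_smul_eq {g : G} {y : Y} (hg : g • y = y) :
    (S.transition g y : G) = (S.lift y)⁻¹ * g * S.lift y := by
  have h := S.lift_smul_mul_transition g y
  rw [hg] at h
  rw [mul_assoc, ← h, inv_mul_cancel_left]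

/-- The cocycle on `Y` determined by homomorphisms on the stabilisers of the representatives. -/
def inducedCocycle (ι : ∀ q, stabilizer G (S.rep q) →* P) (g : G) (y : Y) : P :=
  ι (Quotient.mk'' y) (S.transition g y)

variable {ι : ∀ q, stabilizer G (S.rep q) →* P}

theorem inducedCocycle_eq {g : G} {y : Y} {q : orbitRel.Quotient G Y} (hq : Quotient.mk'' y = q)
    (s : stabilizer G (S.rep q)) (hs : S.lift (g • y) * s = g * S.lift y) :
    S.inducedCocycle ι g y = ι q s := by
  subst hq
  refine congrArg (ι _) (Subtype.ext (mul_left_cancel (a := S.lift (g • y)) ?_))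
  rw [S.lift_smul_mul_transition, hs]

theorem isCocycle_inducedCocycle : IsCocycle (S.inducedCocycle ι) := by
  intro g h y
  have hg : (S.transition g (h • y) : G) ∈ stabilizer G (S.rep (Quotient.mk'' y)) :=
    S.rep_mk_smul h y ▸ (S.transition g (h • y)).2
  rw [S.inducedCocycle_eq (orbitRel_mk_smul h y) ⟨_, hg⟩ (S.lift_smul_mul_transition g (h • y))]
  refine (S.inducedCocycle_eq rfl (⟨_, hg⟩ * S.transition h y) ?_).trans (map_mul _ _ _)
  rw [Subgroup.coe_mul, ← mul_assoc, mul_smul, S.lift_smul_mul_transition, mul_assoc,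
    S.lift_smul_mul_transition, mul_assoc]

theorem inducedCocycle_rep {q : orbitRel.Quotient G Y} (g : stabilizer G (S.rep q)) :
    S.inducedCocycle ι g (S.rep q) = ι q g :=
  S.inducedCocycle_eq (S.mk_rep q) g (by
    rw [show (g : G) • S.rep q = S.rep q from g.2, S.lift_rep, one_mul, mul_one])

end OrbitSection

namespace IsCocycle

variable {σ : G → Y → P}

theorem map_one (hσ : IsCocycle σ) (y : Y) : σ 1 y = 1 := by
  simpa only [mul_one, one_smul, left_eq_mul] using hσ 1 1 y

theorem exists_cohomologous {σ' : G → Y → P} (hσ : IsCocycle σ) (hσ' : IsCocycle σ')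
    (S : OrbitSection G Y) (τ : orbitRel.Quotient G Y → P)
    (hτ : ∀ q, ∀ g ∈ stabilizer G (S.rep q), σ g (S.rep q) * τ q = τ q * σ' g (S.rep q)) :
    ∃ c : Y → P, (∀ q, c (S.rep q) = τ q) ∧ ∀ g y, c (g • y) * σ' g y = σ g y * c y := by
  refine ⟨fun y => σ (S.lift y) (S.rep (Quotient.mk'' y)) * τ (Quotient.mk'' y) *
    (σ' (S.lift y) (S.rep (Quotient.mk'' y)))⁻¹, fun q => ?_, fun g y => ?_⟩
  · simp only [S.lift_rep, hσ.map_one, hσ'.map_one, one_mul, inv_one, mul_one, S.mk_rep]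
  · have htransition : ∀ {ρ : G → Y → P}, IsCocycle ρ →
        ρ g y * ρ (S.lift y) (S.rep (Quotient.mk'' y)) =
          ρ (S.lift (g • y)) (S.rep (Quotient.mk'' y)) *
            ρ (S.transition g y) (S.rep (Quotient.mk'' y)) := by
      intro ρ hρ
      have hfix := mem_stabilizer_iff.1 (S.transition g y).2
      have h := hρ (S.lift (g • y)) (S.transition g y) (S.rep (Quotient.mk'' y))
      rwa [S.lift_smul_mul_transition, hρ, S.lift_smul_rep, hfix] at h
    have h := htransition hσ
    have h' := eq_mul_inv_of_mul_eq (htransition hσ')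
    have hconj := hτ _ _ (S.transition g y).2
    simp only [orbitRel_mk_smul]
    rw [h', ← mul_assoc, ← mul_assoc (σ g y), ← mul_assoc (σ g y), h,
      mul_assoc _ _ (τ (Quotient.mk'' y)), hconj]
    group

end IsCocycle

end Cocycles

section Trees

variable {V : Type*} {T : SimpleGraph V}

theorem eq_of_connected_of_forall_adj {α : Type*} (hT : T.Preconnected) {f : V → α}
    (hf : ∀ v w, T.Adj v w → f v = f w) (v w : V) : f v = f w := by
  obtain ⟨p⟩ := hT v w
  induction p with
  | nil => rfl
  | cons h _ ih => exact (hf _ _ h).trans ih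

theorem exists_potential {P : Type*} [Group P] (hT : T.IsTree) (v₀ : V) (c : V → V → P)
    (hc : ∀ v w, T.Adj v w → c w v = (c v w)⁻¹) :
    ∃ f : V → P, f v₀ = 1 ∧ ∀ v w, T.Adj v w → f w = f v * c v w := by
  let weight : ∀ {w : V}, T.Walk v₀ w → P := fun p => (p.darts.map fun d => c d.fst d.snd).prod
  choose p hp hp_unique using fun w => hT.existsUnique_path v₀ w
  have hconcat : ∀ v w, T.Adj v w → v ∈ (p w).support → weight (p w) = weight (p v) * c v w := by
    intro v w h hv
    rw [hT.isAcyclic.path_concat (hp v) (hp w) h hv]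
    simp [weight, SimpleGraph.Walk.darts_concat]
  refine ⟨fun w => weight (p w), ?_, fun v w h => ?_⟩
  · change weight (p v₀) = 1
    rw [← hp_unique v₀ SimpleGraph.Walk.nil SimpleGraph.Walk.IsPath.nil]
    simp [weight]
  · by_cases hv : v ∈ (p w).support
    · exact hconcat v w h hv
    · have hw := hT.isAcyclic.mem_support_of_ne_mem_support_of_adj_of_isPath (hp v) (hp w) h hv
      change weight (p w) = weight (p v) * c v w
      rw [hconcat w v h.symm hw, hc v w h, inv_mul_cancel_right]

variable {G : Type*} [Group G] [MulAction G V]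

/-- The invariant set `O` of ordered pairs contains exactly one orientation of every edge of `T`. -/
structure IsOrientation (T : SimpleGraph V) (O : SubMulAction G (V × V)) : Prop where
  adj : ∀ d ∈ O, T.Adj d.1 d.2
  mem_or_swap_mem : ∀ d : V × V, T.Adj d.1 d.2 → d ∈ O ∨ d.swap ∈ O
  swap_notMem : ∀ d ∈ O, d.swap ∉ O

theorem exists_isOrientation
    (hadj : ∀ (g : G) (v w : V), T.Adj v w → T.Adj (g • v) (g • w))
    (hinv : ∀ (g : G) (v w : V), T.Adj v w → ¬ (g • v = w ∧ g • w = v)) :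
    ∃ O : SubMulAction G (V × V), IsOrientation T O := by
  let q : V × V → MulAction.orbitRel.Quotient G (V × V) := Quotient.mk''
  have hne : ∀ d : V × V, T.Adj d.1 d.2 → q d ≠ q d.swap := by
    intro d hd hq
    obtain ⟨g, hg⟩ := exists_smul_eq_of_orbitRel_mk_eq hq
    exact hinv g d.1 d.2 hd ⟨congrArg Prod.snd hg, congrArg Prod.fst hg⟩
  -- An edge is oriented by comparing the orbits of its two orientations in an auxiliary order.
  refine ⟨⟨{d | T.Adj d.1 d.2 ∧ WellOrderingRel (q d) (q d.swap)}, fun g d hd => ?_⟩,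
    fun d hd => hd.1, fun d hd => ?_, fun d hd hd' => ?_⟩
  · refine ⟨hadj g _ _ hd.1, ?_⟩
    rw [Prod.smul_swap]
    simpa only [q, orbitRel_mk_smul] using hd.2
  · rcases trichotomous_of WellOrderingRel (q d) (q d.swap) with h | h | h
    · exact Or.inl ⟨hd, h⟩
    · exact (hne d hd h).elim
    · exact Or.inr ⟨hd.symm, h⟩
  · exact asymm hd.2 hd'.2

namespace IsOrientation

variable {O : SubMulAction G (V × V)} {P : Type*} [Group P]

theorem smul_adj (hO : IsOrientation T O) (g : G) {v w : V} (h : T.Adj v w) :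
    T.Adj (g • v) (g • w) := by
  rcases hO.mem_or_swap_mem (v, w) h with hd | hd
  · exact hO.adj _ (O.smul_mem g hd)
  · exact (hO.adj _ (O.smul_mem g hd)).symm

theorem eq_of_forall_mem {α : Type*} (hO : IsOrientation T O) (hT : T.IsTree) {f : V → α}
    (hf : ∀ d ∈ O, f d.1 = f d.2) (v w : V) : f v = f w :=
  eq_of_connected_of_forall_adj hT.connected.preconnected (fun v w h =>
    (hO.mem_or_swap_mem (v, w) h).elim (hf _) fun hd => (hf _ hd).symm) v w

theorem exists_potential (hO : IsOrientation T O) (hT : T.IsTree) (v₀ : V) (c : O → P) :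
    ∃ f : V → P, f v₀ = 1 ∧ ∀ d : O, f d.1.2 = f d.1.1 * c d := by
  classical
  let c' : V → V → P := fun v w => if h : (v, w) ∈ O then c ⟨_, h⟩ else
    if h : (w, v) ∈ O then (c ⟨_, h⟩)⁻¹ else 1
  have hc' : ∀ v w (h : (v, w) ∈ O), c' v w = c ⟨_, h⟩ ∧ c' w v = (c ⟨_, h⟩)⁻¹ := by
    intro v w h
    have h' : (w, v) ∉ O := hO.swap_notMem _ h
    simp only [c', h, h', dif_pos, dif_neg, not_false_eq_true, and_self]
  obtain ⟨f, hf₀, hf⟩ := _root_.exists_potential hT v₀ c' (by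
    intro v w hvw
    rcases hO.mem_or_swap_mem (v, w) hvw with h | h
    · rw [(hc' v w h).1, (hc' v w h).2]
    · rw [(hc' w v h).1, (hc' w v h).2, inv_inv])
  exact ⟨f, hf₀, fun d => by rw [hf _ _ (hO.adj _ d.2), (hc' _ _ d.2).1]⟩

theorem exists_hom_of_isCocycle (hO : IsOrientation T O) (hT : T.IsTree) (v₀ : V)
    {σ : G → V → P} (hσ : IsCocycle σ) (E : OrbitSection G O)
    (τ : MulAction.orbitRel.Quotient G O → P)
    (hτ : ∀ q, ∀ g ∈ MulAction.stabilizer G (E.rep q),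
      σ g (E.rep q).1.1 * τ q = τ q * σ g (E.rep q).1.2) :
    ∃ (f : V → P) (φ : G →* P), f v₀ = 1 ∧
      (∀ q, f (E.rep q).1.2 = f (E.rep q).1.1 * τ q) ∧
      ∀ g v, φ g * f v = f (g • v) * σ g v := by
  have hσ_fst : IsCocycle fun g (d : O) => σ g d.1.1 := fun g h d => hσ g h d.1.1
  have hσ_snd : IsCocycle fun g (d : O) => σ g d.1.2 := fun g h d => hσ g h d.1.2
  obtain ⟨c, hcτ, hc⟩ := hσ_fst.exists_cohomologous hσ_snd E τ hτ
  obtain ⟨f, hf₀, hf⟩ := hO.exists_potential hT v₀ c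
  have hconst : ∀ g v w, f (g • v) * σ g v * (f v)⁻¹ = f (g • w) * σ g w * (f w)⁻¹ := by
    intro g
    refine hO.eq_of_forall_mem hT (f := fun v => f (g • v) * σ g v * (f v)⁻¹) fun d hd => ?_
    have hgd : f (g • d.2) = f (g • d.1) * c (g • ⟨d, hd⟩) := hf (g • ⟨d, hd⟩)
    simp only [hgd, hf ⟨d, hd⟩, mul_assoc _ (c (g • _)) _, hc g ⟨d, hd⟩]
    group
  let φ : G →* P := MonoidHom.mk' (fun g => f (g • v₀) * σ g v₀ * (f v₀)⁻¹) fun g h => by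
    rw [hconst g v₀ (h • v₀), hσ, mul_smul]
    group
  refine ⟨f, φ, hf₀, fun q => by rw [hf, hcτ], fun g v => ?_⟩
  change f (g • v₀) * σ g v₀ * (f v₀)⁻¹ * f v = _
  rw [hconst g v₀ v, inv_mul_cancel_right]

end IsOrientation

end Trees

section FreeActions

open MulAction

variable {S X Y : Type*} [Group S] [MulAction S X] [MulAction S Y]

/-- A free `S`-set is the product of its set of orbits with `S`. -/
@[simps]
def OrbitSection.equivProd (A : OrbitSection S X) (hfree : ∀ (s : S) (x : X), s • x = x → s = 1) :
    X ≃ orbitRel.Quotient S X × S where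
  toFun x := (Quotient.mk'' x, A.lift x)
  invFun p := p.2 • A.rep p.1
  left_inv := A.lift_smul_rep
  right_inv := fun ⟨q, s⟩ => by
    have hmk : Quotient.mk'' (s • A.rep q) = q := by rw [orbitRel_mk_smul, A.mk_rep]
    have hlift := A.lift_smul_rep (s • A.rep q)
    rw [hmk, ← inv_smul_eq_iff, ← mul_smul] at hlift
    exact Prod.ext hmk (inv_mul_eq_one.1 (hfree _ _ hlift)).symm

theorem exists_equivariant_equiv_of_free [Finite X] (e : X ≃ Y)
    (hX : ∀ (s : S) (x : X), s • x = x → s = 1) (hY : ∀ (s : S) (y : Y), s • y = y → s = 1) :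
    ∃ f : X ≃ Y, ∀ (s : S) (x : X), f (s • x) = s • f x := by
  have : Finite Y := .of_equiv X e
  rcases isEmpty_or_nonempty X with hempty | ⟨⟨x₀⟩⟩
  · exact ⟨e, fun s x => isEmptyElim x⟩
  have : Finite S := Finite.of_injective (fun s : S => s • x₀) fun s s' h => by
    have h' : (s'⁻¹ * s) • x₀ = x₀ := by rw [mul_smul, inv_smul_eq_iff]; exact h
    exact (inv_mul_eq_one.1 (hX _ _ h')).symm
  obtain ⟨A, -⟩ := exists_orbitSection (G := S) (Set.injOn_empty (α := X) _)
  obtain ⟨B, -⟩ := exists_orbitSection (G := S) (Set.injOn_empty (α := Y) _)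
  have hcard : Nat.card (orbitRel.Quotient S X) = Nat.card (orbitRel.Quotient S Y) := by
    refine Nat.eq_of_mul_eq_mul_right (Nat.card_pos (α := S)) ?_
    rw [← Nat.card_prod, ← Nat.card_prod, ← Nat.card_congr (A.equivProd hX),
      ← Nat.card_congr (B.equivProd hY), Nat.card_congr e]
  obtain ⟨ω⟩ := Finite.card_eq.1 hcard
  refine ⟨(A.equivProd hX).trans ((ω.prodCongr (Equiv.refl S)).trans (B.equivProd hY).symm),
    fun s x => ?_⟩
  have hlift : A.lift (s • x) = s * A.lift x := by
    rw [← A.lift_smul_mul_transition s x, hX _ _ (A.transition s x).2, mul_one]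
  simp only [Equiv.trans_apply, OrbitSection.equivProd_apply, Equiv.prodCongr_apply, Prod.map,
    OrbitSection.equivProd_symm_apply, Equiv.refl_apply, orbitRel_mk_smul, hlift, mul_smul]

theorem exists_perm_intertwining_of_free {S X : Type*} [Group S] [Finite X]
    (a b : S →* Equiv.Perm X) (ha : ∀ s x, a s x = x → s = 1) (hb : ∀ s x, b s x = x → s = 1) :
    ∃ τ : Equiv.Perm X, ∀ s, a s * τ = τ * b s := by
  obtain ⟨τ, hτ⟩ := @exists_equivariant_equiv_of_free S X X _ (MulAction.compHom X b)
    (MulAction.compHom X a) _ (Equiv.refl X) hb ha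
  exact ⟨τ, fun s => Equiv.ext fun x => (hτ s x).symm⟩

end FreeActions

section FiniteQuotient

open MulAction

variable {V : Type*} {T : SimpleGraph V} {G : Type*} [Group G] [MulAction G V]
  {O : SubMulAction G (V × V)}

/-- The restriction of a cocycle to the stabiliser of a point, which is a homomorphism. -/
@[simps]
def IsCocycle.stabilizerHom {Y P : Type*} [MulAction G Y] [Group P] {σ : G → Y → P}
    (hσ : IsCocycle σ) (y : Y) : stabilizer G y →* P where
  toFun g := σ g y
  map_one' := hσ.map_one y
  map_mul' g h := by rw [Subgroup.coe_mul, hσ, h.2]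

theorem IsOrientation.exists_hom_perm (hO : IsOrientation T O) (hT : T.IsTree) {X : Type*}
    [Finite X] {σ : G → V → Equiv.Perm X} (hσ : IsCocycle σ)
    (hfree : ∀ v w, T.Adj v w → ∀ g : G, g • v = v → g • w = w → ∀ x, σ g v x = x → g = 1) :
    ∃ (f : V → Equiv.Perm X) (φ : G →* Equiv.Perm X), ∀ g v, φ g * f v = f (g • v) * σ g v := by
  obtain ⟨v₀⟩ := hT.connected.nonempty
  obtain ⟨E, -⟩ := exists_orbitSection (G := G) (Set.injOn_empty (α := O) _)
  have hσ_fst : IsCocycle fun g (d : O) => σ g d.1.1 := fun g h d => hσ g h d.1.1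
  have hσ_snd : IsCocycle fun g (d : O) => σ g d.1.2 := fun g h d => hσ g h d.1.2
  have hfix : ∀ (d : O) (g : stabilizer G d), (g : G) • d.1.1 = d.1.1 ∧ (g : G) • d.1.2 = d.1.2 :=
    fun d g => Prod.ext_iff.1 (Subtype.ext_iff.1 g.2)
  choose τ hτ using fun q => exists_perm_intertwining_of_free
    (hσ_fst.stabilizerHom (E.rep q)) (hσ_snd.stabilizerHom (E.rep q))
    (fun g x hx => Subtype.ext <|
      hfree _ _ (hO.adj _ (E.rep q).2) g (hfix _ g).1 (hfix _ g).2 x hx)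
    (fun g x hx => Subtype.ext <|
      hfree _ _ (hO.adj _ (E.rep q).2).symm g (hfix _ g).2 (hfix _ g).1 x hx)
  obtain ⟨f, φ, -, -, hφ⟩ :=
    hO.exists_hom_of_isCocycle hT v₀ hσ E τ fun q g hg => hτ q ⟨g, hg⟩
  exact ⟨f, φ, hφ⟩

theorem OrbitSection.eq_one_of_transition_eq_one {Y : Type*} [MulAction G Y]
    (S : OrbitSection G Y) {g : G} {y : Y} (hg : g • y = y) (h : S.transition g y = 1) :
    g = 1 := by
  have hcoe := S.coe_transition_of_smul_eq hg
  rwa [h, Subgroup.coe_one, mul_assoc, eq_comm, inv_mul_eq_one, eq_comm, mul_eq_right] at hcoe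

theorem OrbitSection.eq_one_of_transition_mem (S : OrbitSection G V)
    (hadj : ∀ (g : G) (v w : V), T.Adj v w → T.Adj (g • v) (g • w))
    {N : ∀ q, Subgroup (stabilizer G (S.rep q))}
    (hN : ∀ q w, T.Adj (S.rep q) w → ∀ g ∈ N q, (g : G) • w = w → g = 1)
    {v w : V} (hvw : T.Adj v w) {g : G} (hv : g • v = v) (hw : g • w = w)
    (hg : S.transition g v ∈ N (Quotient.mk'' v)) : g = 1 := by
  refine S.eq_one_of_transition_eq_one hv
    (hN _ ((S.lift v)⁻¹ • w) (S.lift_inv_smul v ▸ hadj _ _ _ hvw) _ hg ?_)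
  rw [S.coe_transition_of_smul_eq hv, mul_smul, mul_smul, smul_inv_smul, hw]

theorem IsOrientation.exists_finiteIndex_transition_mem (hO : IsOrientation T O)
    (hT : T.IsTree) [Finite (orbitRel.Quotient G V)] (S : OrbitSection G V)
    (N : ∀ q, Subgroup (stabilizer G (S.rep q))) [∀ q, (N q).Normal] [∀ q, (N q).FiniteIndex]
    (hN : ∀ q w, T.Adj (S.rep q) w → ∀ g ∈ N q, (g : G) • w = w → g = 1) :
    ∃ K : Subgroup G, K.FiniteIndex ∧
      ∀ g ∈ K, ∀ v, g • v = v → S.transition g v ∈ N (Quotient.mk'' v) := by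
  classical
  -- Each `G_q` acts on `X` through the free action of its factor `G_q ⧸ N q`, so that the edge
  -- groups, which embed in these factors, act freely.
  let X := ∀ q, stabilizer G (S.rep q) ⧸ N q
  let ι : ∀ q, stabilizer G (S.rep q) →* Equiv.Perm X := fun q =>
    (toPermHom X X).comp ((MonoidHom.mulSingle _ q).comp (QuotientGroup.mk' (N q)))
  have hι : ∀ q g x, ι q g x = x → g ∈ N q := by
    intro q g x hx
    have hsingle : Pi.mulSingle q (g : stabilizer G (S.rep q) ⧸ N q) = (1 : X) :=
      mul_eq_right.1 hx
    exact (QuotientGroup.eq_one_iff g).1 (Pi.mulSingle_eq_one_iff.1 hsingle)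
  obtain ⟨f, φ, hφ⟩ := hO.exists_hom_perm hT (S.isCocycle_inducedCocycle (ι := ι))
    fun v w hvw g hv hw x hx =>
      S.eq_one_of_transition_mem (fun g v w => hO.smul_adj g) hN hvw hv hw (hι _ _ x hx)
  refine ⟨φ.ker, inferInstance, fun g hg v hv => hι _ _ 1 ?_⟩
  have hσ : S.inducedCocycle ι g v = 1 := by
    have h := hφ g v
    rwa [MonoidHom.mem_ker.1 hg, hv, one_mul, left_eq_mul] at h
  rw [← OrbitSection.inducedCocycle, hσ, Equiv.Perm.one_apply]

theorem finite_orbitRel_quotient {Y : Type*} [MulAction G Y] {F : Set Y} (hF : F.Finite)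
    (h : ∀ y, ∃ g : G, g • y ∈ F) : Finite (orbitRel.Quotient G Y) := by
  have := hF.to_subtype
  refine Finite.of_surjective
    (fun y : F => (Quotient.mk'' y.1 : orbitRel.Quotient G Y)) fun q => ?_
  obtain ⟨y, rfl⟩ := Quotient.mk''_surjective q
  obtain ⟨g, hg⟩ := h y
  exact ⟨⟨g • y, hg⟩, orbitRel_mk_smul g y⟩

theorem IsStallingsDunwoody.finite_vertex_quotient {G : Type u} [Group G] {V : Type v}
    [MulAction G V] {T : SimpleGraph V} (hT : IsStallingsDunwoody G T) :
    Finite (orbitRel.Quotient G V) :=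
  let ⟨_, hF, h⟩ := hT.finite_vertex_orbits
  finite_orbitRel_quotient hF h

theorem IsStallingsDunwoody.exists_finiteIndex_free_on_edges {G : Type u} [Group G] {V : Type v}
    [MulAction G V] {T : SimpleGraph V} (hT : IsStallingsDunwoody G T)
    (hsep : ∀ v : V, IsOneEnded (stabilizer G v) →
      ∃ N : Subgroup (stabilizer G v), N.Normal ∧ N.FiniteIndex ∧
        ∀ w : V, T.Adj v w → N ⊓ (stabilizer G w).subgroupOf (stabilizer G v) = ⊥) :
    ∃ K : Subgroup G, K.FiniteIndex ∧
      (∀ v w, T.Adj v w → ∀ g ∈ K, g • v = v → g • w = w → g = 1) ∧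
      ∀ v : V, Finite (stabilizer G v) → ∀ g ∈ K, g • v = v → g = 1 := by
  have := hT.finite_vertex_quotient
  obtain ⟨O, hO⟩ := exists_isOrientation hT.smul_adj hT.no_inversion
  obtain ⟨S, -⟩ := exists_orbitSection (G := G) (Set.injOn_empty (α := V) _)
  have hN : ∀ v : V, ∃ N : Subgroup (stabilizer G v), N.Normal ∧ N.FiniteIndex ∧
      (∀ w, T.Adj v w → ∀ g ∈ N, (g : G) • w = w → g = 1) ∧
      (Finite (stabilizer G v) → N = ⊥) := by
    intro v
    by_cases hfin : Finite (stabilizer G v)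
    · exact ⟨⊥, inferInstance, inferInstance, fun w _ g hg _ => hg, fun _ => rfl⟩
    · obtain ⟨N, hnormal, hindex, hinf⟩ := hsep v ((hT.vertex_group v).resolve_left hfin)
      refine ⟨N, hnormal, hindex, fun w hw g hg hgw => ?_, fun h => (hfin h).elim⟩
      exact Subgroup.mem_bot.1 (hinf w hw ▸ ⟨hg, hgw⟩)
  choose N _ _ hNedge hNbot using fun q => hN (S.rep q)
  obtain ⟨K, hK, hmem⟩ := hO.exists_finiteIndex_transition_mem hT.isTree S N hNedge
  refine ⟨K, hK, fun v w hvw g hg hv hw =>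
    S.eq_one_of_transition_mem hT.smul_adj hNedge hvw hv hw (hmem g hg v hv), ?_⟩
  intro v hfin g hg hv
  have hrep : Finite (stabilizer G (S.rep (Quotient.mk'' v))) :=
    .of_equiv _ (stabilizerEquivStabilizer (S.lift_inv_smul v).symm).toEquiv
  exact S.eq_one_of_transition_eq_one hv
    (Subgroup.mem_bot.1 (hNbot _ hrep ▸ hmem g hg v hv))

end FiniteQuotient

section FundamentalTree

open MulAction

variable {V : Type*} {T : SimpleGraph V} {G : Type*} [Group G] [MulAction G V]
  {O : SubMulAction G (V × V)}

theorem exists_maximal_connected_injOn {α : Type*} (T : SimpleGraph V) (f : V → α) (v₀ : V) :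
    ∃ R : Set V, v₀ ∈ R ∧ Maximal (fun R => (T.induce R).Connected ∧ R.InjOn f) R := by
  have hchain : ∀ c ⊆ {R | (T.induce R).Connected ∧ R.InjOn f}, IsChain (· ⊆ ·) c →
      c.Nonempty → ∃ R ∈ {R | (T.induce R).Connected ∧ R.InjOn f}, ∀ s ∈ c, s ⊆ R := by
    intro c hc hchain hne
    refine ⟨⋃₀ c, ⟨SimpleGraph.induce_sUnion_connected_of_pairwise_not_disjoint hne ?_
      fun hs => (hc hs).1, ?_⟩, fun s hs => Set.subset_sUnion_of_mem hs⟩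
    · intro s t hs ht
      obtain ⟨⟨x, hx⟩⟩ := (hc hs).1.nonempty
      obtain ⟨⟨y, hy⟩⟩ := (hc ht).1.nonempty
      exact (hchain.total hs ht).elim (fun h => ⟨x, hx, h hx⟩) fun h => ⟨y, h hy, hy⟩
    · rintro x ⟨s, hs, hx⟩ y ⟨t, ht, hy⟩ hxy
      obtain ⟨r, hr, hsr, htr⟩ := hchain.directedOn s hs t ht
      exact (hc hr).2 (hsr hx) (htr hy) hxy
  obtain ⟨R, hv₀, hR⟩ := zorn_subset_nonempty _ hchain {v₀}
    ⟨.of_subsingleton, Set.injOn_singleton _ _⟩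
  exact ⟨R, hv₀ rfl, hR⟩

theorem exists_connected_transversal (hT : T.Connected)
    (hadj : ∀ (g : G) (v w : V), T.Adj v w → T.Adj (g • v) (g • w)) :
    ∃ R : Set V, (T.induce R).Connected ∧
      R.InjOn (Quotient.mk'' : V → orbitRel.Quotient G V) ∧
      ∀ v : V, ∃ g : G, g • v ∈ R := by
  obtain ⟨v₀⟩ := hT.nonempty
  obtain ⟨R, hv₀, ⟨hconn, hinj⟩, hmax⟩ :=
    exists_maximal_connected_injOn T (Quotient.mk'' : V → orbitRel.Quotient G V) v₀
  refine ⟨R, hconn, hinj, ?_⟩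
  by_contra! hmissed
  obtain ⟨u, hu⟩ := hmissed
  obtain ⟨p⟩ := hT.preconnected v₀ u
  obtain ⟨d, -, ⟨g, hg⟩, hd⟩ := p.exists_boundary_dart {v | ∃ g : G, g • v ∈ R}
    ⟨1, by simpa only [one_smul] using hv₀⟩ (fun ⟨g, hg⟩ => hu g hg)
  have hnew : ∀ r ∈ R, (Quotient.mk'' (g • d.snd) : orbitRel.Quotient G V) ≠ Quotient.mk'' r := by
    intro r hr h
    obtain ⟨k, hk⟩ := exists_smul_eq_of_orbitRel_mk_eq h.symm
    exact hd ⟨k * g, by rwa [mul_smul, hk]⟩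
  have hconn' : (T.induce (insert (g • d.snd) R)).Connected := by
    rw [Set.insert_eq, Set.union_comm]
    exact SimpleGraph.connected_induce_union hconn.preconnected .of_subsingleton hg rfl
      (hadj g _ _ d.adj)
  have hinj' : (insert (g • d.snd) R).InjOn (Quotient.mk'' : V → orbitRel.Quotient G V) :=
    (Set.injOn_insert fun h => hnew _ h rfl).2 ⟨hinj, fun ⟨r, hr, h⟩ => hnew r hr h.symm⟩
  exact hnew _ (hmax ⟨hconn', hinj'⟩ (Set.subset_insert _ _) (Set.mem_insert _ _)) rfl

/-- The orbit representatives `S` of the vertices span a connected subgraph of `T`, and the edges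
of this subgraph are among the orbit representatives `E` of the oriented edges. -/
structure IsFundamentalTree (T : SimpleGraph V) (S : OrbitSection G V) (E : OrbitSection G O) :
    Prop where
  connected : (T.induce (Set.range S.rep)).Connected
  rep_mk (d : O) : d.1.1 ∈ Set.range S.rep → d.1.2 ∈ Set.range S.rep → E.rep (Quotient.mk'' d) = d

theorem IsOrientation.exists_isFundamentalTree (hO : IsOrientation T O) (hT : T.Connected) :
    ∃ (S : OrbitSection G V) (E : OrbitSection G O), IsFundamentalTree T S E := by
  obtain ⟨R, hconn, hinj, hmem⟩ :=
    exists_connected_transversal (G := G) hT fun g v w => hO.smul_adj g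
  obtain ⟨S, hS⟩ := exists_orbitSection hinj
  have hrange : Set.range S.rep = R := by
    refine Set.Subset.antisymm ?_ fun r hr => ⟨_, hS r hr⟩
    rintro _ ⟨q, rfl⟩
    obtain ⟨g, hg⟩ := hmem (S.rep q)
    have h := hS _ hg
    rw [S.rep_mk_smul, S.mk_rep] at h
    rwa [h]
  obtain ⟨E, hE⟩ := exists_orbitSection (G := G) (A := {d : O | d.1.1 ∈ R ∧ d.1.2 ∈ R}) (by
    intro d hd d' hd' h
    obtain ⟨g, rfl⟩ := exists_smul_eq_of_orbitRel_mk_eq h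
    exact Subtype.ext (Prod.ext (hinj hd.1 hd'.1 (orbitRel_mk_smul g _))
      (hinj hd.2 hd'.2 (orbitRel_mk_smul g _))))
  exact ⟨S, E, hrange ▸ hconn, fun d h₁ h₂ => hE d ⟨hrange ▸ h₁, hrange ▸ h₂⟩⟩

end FundamentalTree

section FreeSplitting

open MulAction

variable {V : Type*} {T : SimpleGraph V} {G : Type*} [Group G] [MulAction G V]
  {O : SubMulAction G (V × V)} (S : OrbitSection G V) (E : OrbitSection G O)

/-- The element attached to an orbit of oriented edges: if its representative joins `g • r` to
`g' • r'`, where `r` and `r'` represent orbits of vertices and `g` and `g'` are chosen by `S`, then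
the stable letter is `g⁻¹ * g'`. -/
def stableLetter (q : orbitRel.Quotient G O) : G :=
  (S.lift (E.rep q).1.1)⁻¹ * S.lift (E.rep q).1.2

/-- The representative of the orbit of oriented edges joins two vertex representatives, so that its
stable letter is trivial. -/
def IsTreeEdge (q : orbitRel.Quotient G O) : Prop :=
  (E.rep q).1.1 ∈ Set.range S.rep ∧ (E.rep q).1.2 ∈ Set.range S.rep

variable {S E}

theorem stableLetter_eq_one {q : orbitRel.Quotient G O} (hq : IsTreeEdge S E q) :
    stableLetter S E q = 1 := by
  obtain ⟨⟨q₁, h₁⟩, ⟨q₂, h₂⟩⟩ := hq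
  rw [stableLetter, ← h₁, ← h₂, S.lift_rep, S.lift_rep, inv_one, one_mul]

theorem IsFundamentalTree.exists_hom {P : Type*} [Group P] (hSE : IsFundamentalTree T S E)
    (hO : IsOrientation T O) (hT : T.IsTree)
    (hfree : ∀ v w, T.Adj v w → ∀ g : G, g • v = v → g • w = w → g = 1)
    (ι : ∀ q, stabilizer G (S.rep q) →* P) (τ : orbitRel.Quotient G O → P)
    (hτ : ∀ q, IsTreeEdge S E q → τ q = 1) :
    ∃ φ : G →* P, (∀ q (g : stabilizer G (S.rep q)), φ g = ι q g) ∧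
      ∀ q, φ (stableLetter S E q) = τ q := by
  obtain ⟨⟨v₀, hv₀⟩⟩ := hSE.connected.nonempty
  have hσ := S.isCocycle_inducedCocycle (ι := ι)
  obtain ⟨f, φ, hf₀, hf, hφ⟩ := hO.exists_hom_of_isCocycle hT v₀ hσ E τ (by
    intro q g hg
    have hfix := Prod.ext_iff.1 (Subtype.ext_iff.1 (mem_stabilizer_iff.1 hg))
    rw [hfree _ _ (hO.adj _ (E.rep q).2) g hfix.1 hfix.2, hσ.map_one, hσ.map_one, one_mul,
      mul_one])
  have hf_edge : ∀ d : O, d.1.1 ∈ Set.range S.rep → d.1.2 ∈ Set.range S.rep →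
      f d.1.1 = f d.1.2 := by
    intro d h₁ h₂
    have hd := hSE.rep_mk d h₁ h₂
    have h := hf (Quotient.mk'' d)
    rwa [hτ _ (by rw [IsTreeEdge, hd]; exact ⟨h₁, h₂⟩), hd, mul_one, eq_comm] at h
  have hf_rep : ∀ q, f (S.rep q) = 1 := fun q => hf₀ ▸
    eq_of_connected_of_forall_adj hSE.connected.preconnected (f := fun r => f r.1)
      (fun r r' h => (hO.mem_or_swap_mem (r.1, r'.1) h).elim (fun hd => hf_edge ⟨_, hd⟩ r.2 r'.2)
        fun hd => (hf_edge ⟨_, hd⟩ r'.2 r.2).symm)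
      ⟨S.rep q, q, rfl⟩ ⟨v₀, hv₀⟩
  have hφ_rep : ∀ q (g : stabilizer G (S.rep q)), φ g = ι q g := by
    intro q g
    have h := hφ g (S.rep q)
    rwa [g.2, hf_rep, mul_one, one_mul, S.inducedCocycle_rep] at h
  have hφ_lift : ∀ v, φ (S.lift v) = f v := by
    intro v
    have h := hφ (S.lift v) (S.rep (Quotient.mk'' v))
    rwa [hf_rep, mul_one, S.lift_smul_rep, S.inducedCocycle_eq (S.mk_rep _) 1 (by
      rw [S.lift_smul_rep, S.lift_rep, Subgroup.coe_one]), map_one, mul_one] at h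
  refine ⟨φ, hφ_rep, fun q => ?_⟩
  rw [stableLetter, map_mul, map_inv, hφ_lift, hφ_lift, hf, inv_mul_cancel_left]

theorem IsOrientation.eq_top_of_stabilizer_le (hO : IsOrientation T O) (hT : T.IsTree)
    {H : Subgroup G} (hstab : ∀ q, stabilizer G (S.rep q) ≤ H)
    (hletter : ∀ q, stableLetter S E q ∈ H) : H = ⊤ := by
  obtain ⟨v₀⟩ := hT.connected.nonempty
  have htransition : ∀ g v, (S.transition g v : G) ∈ H := fun g v => hstab _ (S.transition g v).2
  have hedge : ∀ d ∈ O, (S.lift d.1 : G ⧸ H) = S.lift d.2 := by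
    intro d hd
    obtain ⟨g, e, heq⟩ : ∃ (g : G) (q : orbitRel.Quotient G O), g • E.rep q = ⟨d, hd⟩ :=
      ⟨E.lift ⟨d, hd⟩, _, E.lift_smul_rep _⟩
    obtain rfl := Subtype.ext_iff.1 heq
    rw [QuotientGroup.eq]
    have hlift : ∀ v, S.lift (g • v) = g * S.lift v * (S.transition g v : G)⁻¹ := fun v => by
      rw [← S.lift_smul_mul_transition, mul_inv_cancel_right]
    have hletter_conj : (S.lift (g • (E.rep e).1.1))⁻¹ * S.lift (g • (E.rep e).1.2) =
        S.transition g (E.rep e).1.1 * stableLetter S E e *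
          (S.transition g (E.rep e).1.2 : G)⁻¹ := by
      rw [hlift, hlift, stableLetter]
      group
    change (S.lift (g • (E.rep e).1.1))⁻¹ * S.lift (g • (E.rep e).1.2) ∈ H
    rw [hletter_conj]
    exact H.mul_mem (H.mul_mem (htransition _ _) (hletter e)) (H.inv_mem (htransition _ _))
  have hlift : ∀ v, S.lift v ∈ H := by
    intro v
    have h := hO.eq_of_forall_mem hT (f := fun v => (S.lift v : G ⧸ H)) hedge
      (S.rep (Quotient.mk'' v)) v
    rwa [S.lift_rep, QuotientGroup.eq, inv_one, one_mul] at h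
  refine (Subgroup.eq_top_iff' H).2 fun g => ?_
  rw [← mul_inv_cancel_right g (S.lift v₀), ← S.lift_smul_mul_transition]
  exact H.mul_mem (H.mul_mem (hlift _) (htransition _ _)) (H.inv_mem (hlift _))

theorem IsFundamentalTree.bijective_lift (hSE : IsFundamentalTree T S E)
    (hO : IsOrientation T O) (hT : T.IsTree)
    (hfree : ∀ v w, T.Adj v w → ∀ g : G, g • v = v → g • w = w → g = 1) :
    Function.Bijective (Monoid.Coprod.lift
      (Monoid.CoprodI.lift fun q : {q // stabilizer G (S.rep q) ≠ ⊥} =>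
        (stabilizer G (S.rep q)).subtype)
      (FreeGroup.lift fun q : {q // ¬ IsTreeEdge S E q} => stableLetter S E q)) := by
  classical
  let I := {q // stabilizer G (S.rep q) ≠ ⊥}
  let J := {q // ¬ IsTreeEdge S E q}
  let M : I → Type _ := fun q => stabilizer G (S.rep q)
  set Θ := Monoid.Coprod.lift (Monoid.CoprodI.lift fun q : I => (stabilizer G (S.rep q)).subtype)
    (FreeGroup.lift fun q : J => stableLetter S E q) with hΘ
  refine ⟨?_, MonoidHom.range_eq_top.1 (hO.eq_top_of_stabilizer_le hT (S := S) (E := E)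
    (fun q g hg => ?_) fun q => ?_)⟩
  · obtain ⟨φ, hφ, hφ'⟩ := hSE.exists_hom hO hT hfree
      (P := Monoid.Coprod (Monoid.CoprodI M) (FreeGroup J))
      (fun q => if h : stabilizer G (S.rep q) ≠ ⊥ then
        Monoid.Coprod.inl.comp (Monoid.CoprodI.of (M := M) (i := ⟨q, h⟩)) else 1)
      (fun q => if h : ¬ IsTreeEdge S E q then
        Monoid.Coprod.inr (FreeGroup.of (⟨q, h⟩ : J)) else 1)
      fun q hq => dif_neg (not_not.2 hq)
    have hleft : φ.comp Θ = MonoidHom.id _ := by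
      refine Monoid.Coprod.hom_ext (Monoid.CoprodI.ext_hom _ _ fun q => MonoidHom.ext fun g => ?_)
        (FreeGroup.ext_hom _ _ fun q => ?_)
      · simpa [hΘ, q.2] using hφ q g
      · simpa [hΘ, q.2] using hφ' q
    exact Function.LeftInverse.injective (DFunLike.congr_fun hleft)
  · by_cases hq : stabilizer G (S.rep q) = ⊥
    · rw [hq, Subgroup.mem_bot] at hg
      exact hg ▸ one_mem _
    · exact ⟨Monoid.Coprod.inl (Monoid.CoprodI.of (i := ⟨q, hq⟩) ⟨g, hg⟩), by simp [hΘ]⟩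
  · by_cases hq : IsTreeEdge S E q
    · rw [stableLetter_eq_one hq]
      exact one_mem _
    · exact ⟨Monoid.Coprod.inr (FreeGroup.of ⟨q, hq⟩), by simp [hΘ]⟩

end FreeSplitting

section FreeProducts

open Monoid

theorem coprodI_of_cast {I : Type*} {M : I → Type*} [∀ i, Monoid (M i)] {i j : I} (h : i = j)
    (x : M i) : CoprodI.of (MulEquiv.cast h x) = CoprodI.of x := by
  subst h
  rfl

/-- Reindexing a free product along an equivalence of index types. -/
def coprodIReindex {I J : Type*} (e : J ≃ I) (M : I → Type*) [∀ i, Monoid (M i)] :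
    CoprodI (fun j => M (e j)) ≃* CoprodI M :=
  MonoidHom.toMulEquiv
    (CoprodI.lift fun j => CoprodI.of (i := e j))
    (CoprodI.lift fun i => (CoprodI.of (M := fun j => M (e j)) (i := e.symm i)).comp
      (MulEquiv.cast (M := M) (e.apply_symm_apply i).symm).toMonoidHom)
    (by
      refine CoprodI.ext_hom _ _ fun j => MonoidHom.ext fun x => ?_
      simp only [MonoidHom.comp_apply, CoprodI.lift_of, MonoidHom.id_apply]
      exact coprodI_of_cast (M := fun j => M (e j)) (e.symm_apply_apply j).symm x)
    (by
      refine CoprodI.ext_hom _ _ fun i => MonoidHom.ext fun x => ?_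
      simp only [MonoidHom.comp_apply, CoprodI.lift_of, MonoidHom.id_apply]
      exact coprodI_of_cast _ x)

theorem isFreeProductOneEndedFree_of_bijective {K : Type u} [Group K] {I J : Type*} [Finite I]
    [Finite J] (H : I → Subgroup K) (t : J → K) (hH : ∀ i, IsOneEnded (H i))
    (hbij : Function.Bijective
      (Coprod.lift (CoprodI.lift fun i => (H i).subtype) (FreeGroup.lift t))) :
    IsFreeProductOneEndedFree K := by
  obtain ⟨m, ⟨e⟩⟩ := Finite.exists_equiv_fin I
  obtain ⟨r, ⟨e'⟩⟩ := Finite.exists_equiv_fin J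
  refine ⟨m, r, fun i => H (e.symm i), FreeGroup.lift fun j => t (e'.symm j), fun i => hH _, ?_⟩
  have hcomp : Coprod.lift (CoprodI.lift fun i => (H (e.symm i)).subtype)
      (FreeGroup.lift fun j => t (e'.symm j)) =
      (Coprod.lift (CoprodI.lift fun i => (H i).subtype) (FreeGroup.lift t)).comp
        ((coprodIReindex e.symm fun i => H i).coprodCongr
          (FreeGroup.freeGroupCongr e'.symm)).toMonoidHom := by
    refine Coprod.hom_ext (CoprodI.ext_hom _ _ fun i => ?_) ?_
    · ext x
      simp [coprodIReindex]
    · ext j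
      simp
  rw [hcomp]
  exact hbij.comp (MulEquiv.bijective _)

end FreeProducts

section Ends

open SimpleGraph

variable {V : Type u}

/-- The outer vertex boundary of a set `A` of vertices. -/
def outerBoundary (Γ : SimpleGraph V) (A : Set V) : Set V :=
  {y | y ∉ A ∧ ∃ x ∈ A, Γ.Adj x y}

theorem outerBoundary_supp_subset {Γ : SimpleGraph V} {K : Set V} (C : Γ.ComponentCompl K) :
    outerBoundary Γ C.supp ⊆ K := by
  rintro y ⟨hy, x, hx, hxy⟩
  by_contra hyK
  exact hy (C.mem_of_adj x y hx hyK hxy)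

theorem mem_of_mem_supp_of_outerBoundary_subset {Γ : SimpleGraph V} {A K : Set V}
    (hA : outerBoundary Γ A ⊆ K) (C : Γ.ComponentCompl K) {x y : V} (hx : x ∈ C.supp)
    (hy : y ∈ C.supp) (hxA : x ∈ A) : y ∈ A := by
  have hstep : ∀ v w, w ∉ K → Γ.Adj v w → v ∈ A → w ∈ A := fun v w hw h hv =>
    by_contra fun hwA => hw (hA ⟨hwA, v, hv, h⟩)
  let inA : Γ.ComponentCompl K → Prop := ComponentCompl.lift (fun v _ => v ∈ A)
    fun v w hv hw h => propext ⟨hstep v w hw h, hstep w v hv h.symm⟩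
  obtain ⟨hxK, rfl⟩ := hx
  obtain ⟨hyK, hyC⟩ := hy
  change inA (Γ.componentComplMk hyK)
  rw [hyC]
  exact hxA

theorem infinite_supp_of_mem_end {Γ : SimpleGraph V} {e : ∀ K, Γ.componentComplFunctor.obj K}
    (he : e ∈ Γ.end) (K : (Finset V)ᵒᵖ) : (e K).supp.Infinite :=
  (e K).infinite_iff_in_all_ranges.mpr fun L h =>
    ⟨e (Opposite.op L), he (CategoryTheory.opHomOfLE (x := K) (y := Opposite.op L) h)⟩

theorem exists_end_forall_inter_nonempty (Γ : SimpleGraph V) [Γ.LocallyFinite]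
    [Fact Γ.Preconnected] {A : Set V} (hA : A.Infinite) :
    ∃ e ∈ Γ.end, ∀ K, ((e K).supp ∩ A).Nonempty := by
  have hne : (Filter.cofinite ⊓ Filter.principal A).NeBot :=
    Filter.cofinite_inf_principal_neBot_iff.2 hA
  let U : Ultrafilter V := Ultrafilter.of (Filter.cofinite ⊓ Filter.principal A)
  have hU : ↑U ≤ Filter.cofinite ⊓ Filter.principal A := Ultrafilter.of_le _
  have hUA : A ∈ U := hU (Filter.mem_inf_of_right (Filter.mem_principal_self A))
  have hcomponent : ∀ K : (Finset V)ᵒᵖ, ∃ C : Γ.componentComplFunctor.obj K,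
      ComponentCompl.supp C ∈ U := by
    intro K
    have hcover : (⋃ C : Γ.ComponentCompl (K.unop : Set V), C.supp) ∈ U := by
      have hcofinite : (K.unop : Set V)ᶜ ∈ U :=
        hU (Filter.mem_inf_of_left K.unop.finite_toSet.compl_mem_cofinite)
      filter_upwards [hcofinite] with v hv
      exact Set.mem_iUnion.2 ⟨Γ.componentComplMk hv, Γ.componentComplMk_mem hv⟩
    rw [← Set.biUnion_univ, Ultrafilter.finite_biUnion_mem_iff Set.finite_univ] at hcover
    obtain ⟨C, -, hC⟩ := hcover
    exact ⟨C, hC⟩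
  choose e he using hcomponent
  refine ⟨e, fun {K L} h => ?_, fun K => U.nonempty_of_mem (Filter.inter_mem (he K) hUA)⟩
  refine (ComponentCompl.hom_eq_iff_not_disjoint (e K) (CategoryTheory.le_of_op_hom h) (e L)).2 ?_
  exact Set.not_disjoint_iff.2 (U.nonempty_of_mem (Filter.inter_mem (he K) (he L)))

theorem finite_or_finite_compl_of_end_subsingleton {Γ : SimpleGraph V} [Γ.LocallyFinite]
    [Fact Γ.Preconnected] (hΓ : Γ.end.Subsingleton) {A : Set V}
    (hA : (outerBoundary Γ A).Finite) : A.Finite ∨ Aᶜ.Finite := by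
  by_contra! hinf
  obtain ⟨e₁, he₁, h₁⟩ := exists_end_forall_inter_nonempty Γ hinf.1
  obtain ⟨e₂, he₂, h₂⟩ := exists_end_forall_inter_nonempty Γ hinf.2
  obtain rfl := hΓ he₁ he₂
  obtain ⟨x, hx, hxA⟩ := h₁ (Opposite.op hA.toFinset)
  obtain ⟨y, hy, hyA⟩ := h₂ (Opposite.op hA.toFinset)
  exact hyA (mem_of_mem_supp_of_outerBoundary_subset hA.coe_toFinset.ge _ hx hy hxA)

theorem end_subsingleton_of_finite_or_finite_compl {Γ : SimpleGraph V}
    (hΓ : ∀ A : Set V, (outerBoundary Γ A).Finite → A.Finite ∨ Aᶜ.Finite) :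
    Γ.end.Subsingleton := by
  intro e he e' he'
  by_contra hne
  obtain ⟨K, hK⟩ := Function.ne_iff.1 hne
  have hdisj : Disjoint (e' K).supp (e K).supp := ComponentCompl.pairwise_disjoint (Ne.symm hK)
  rcases hΓ _ (K.unop.finite_toSet.subset (outerBoundary_supp_subset (e K))) with h | h
  · exact infinite_supp_of_mem_end he K h
  · exact infinite_supp_of_mem_end he' K (h.subset hdisj.subset_compl_right)

theorem encard_end_eq_one_iff {Γ : SimpleGraph V} [Γ.LocallyFinite] [Fact Γ.Preconnected] :
    Γ.end.encard = 1 ↔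
      Infinite V ∧ ∀ A : Set V, (outerBoundary Γ A).Finite → A.Finite ∨ Aᶜ.Finite := by
  rw [Set.encard_eq_one]
  constructor
  · rintro ⟨e, he⟩
    have hinf := infinite_supp_of_mem_end (he.ge rfl) (Opposite.op ∅)
    refine ⟨Set.infinite_univ_iff.1 (hinf.mono (Set.subset_univ _)), fun A => ?_⟩
    exact finite_or_finite_compl_of_end_subsingleton (he ▸ Set.subsingleton_singleton)
  · rintro ⟨_, hA⟩
    obtain ⟨e, he, -⟩ := exists_end_forall_inter_nonempty Γ Set.infinite_univ
    exact Set.exists_eq_singleton_iff_nonempty_subsingleton.2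
      ⟨⟨e, he⟩, end_subsingleton_of_finite_or_finite_compl hA⟩

variable {G : Type u} [Group G]

/-- A set is almost invariant if every right translate differs from it by a finite set. Applied to
`g` and `g⁻¹`, the condition bounds both halves of the symmetric difference. -/
def AlmostInvariant (A : Set G) : Prop :=
  ∀ g : G, {x | x ∈ A ∧ x * g ∉ A}.Finite

theorem finite_setOf_mul_notMem_mul {A : Set G} {g h : G} (hg : {x | x ∈ A ∧ x * g ∉ A}.Finite)
    (hh : {x | x ∈ A ∧ x * h ∉ A}.Finite) : {x | x ∈ A ∧ x * (g * h) ∉ A}.Finite := by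
  refine (hg.union (hh.preimage (mul_left_injective g).injOn)).subset ?_
  rintro x ⟨hx, hxgh⟩
  by_cases hxg : x * g ∈ A
  · exact Or.inr ⟨hxg, by rwa [mul_assoc]⟩
  · exact Or.inl ⟨hx, hxg⟩

theorem AlmostInvariant.of_closure_eq_top {A S : Set G} (hS : Subgroup.closure S = ⊤)
    (h : ∀ g, g ∈ S ∨ g⁻¹ ∈ S → {x | x ∈ A ∧ x * g ∉ A}.Finite) : AlmostInvariant A := by
  intro g
  induction hS ▸ Subgroup.mem_top g using Subgroup.closure_induction'' with
  | one => simp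
  | mem g hg => exact h g (Or.inl hg)
  | inv_mem g hg => exact h g⁻¹ (Or.inr (by rwa [inv_inv]))
  | mul g h _ _ hg hh => exact finite_setOf_mul_notMem_mul hg hh

theorem preconnected_mulCayley {S : Set G} (hS : Subgroup.closure S = ⊤) :
    (mulCayley S).Preconnected := by
  have hstep : ∀ g, g ∈ S ∨ g⁻¹ ∈ S → ∀ x, (mulCayley S).Reachable x (x * g) := by
    intro g hg x
    by_cases hx : x = x * g
    · rw [← hx]
    · exact Adj.reachable ((mulCayley_adj S _ _).2 ⟨hx, by simpa using hg⟩)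
  have hreach : ∀ g x, (mulCayley S).Reachable x (x * g) := by
    intro g
    induction hS ▸ Subgroup.mem_top g using Subgroup.closure_induction'' with
    | one => intro x; rw [mul_one]
    | mem g hg => exact hstep g (Or.inl hg)
    | inv_mem g hg => exact hstep g⁻¹ (Or.inr (by rwa [inv_inv]))
    | mul g h _ _ hg hh => intro x; exact mul_assoc x g h ▸ (hg x).trans (hh (x * g))
  intro x y
  simpa using hreach (x⁻¹ * y) x

theorem finite_neighborSet_mulCayley {S : Set G} (hS : S.Finite) (x : G) :
    ((mulCayley S).neighborSet x).Finite := by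
  refine ((hS.union hS.inv).image (x * ·)).subset fun y hy => ⟨x⁻¹ * y, ?_, by simp⟩
  simpa using ((mulCayley_adj _ _ _).1 hy).2

theorem almostInvariant_iff_finite_outerBoundary {S : Set G} (hS : Subgroup.closure S = ⊤)
    (hfin : S.Finite) {A : Set G} :
    AlmostInvariant A ↔ (outerBoundary (mulCayley S) A).Finite := by
  constructor
  · intro hA
    refine ((hfin.union hfin.inv).biUnion fun g _ => (hA g).image (· * g)).subset ?_
    rintro y ⟨hy, x, hx, hxy⟩
    refine Set.mem_biUnion (x := x⁻¹ * y) ?_ ⟨x, ⟨hx, by simpa using hy⟩, by simp⟩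
    simpa using ((mulCayley_adj _ _ _).1 hxy).2
  · intro hA
    refine AlmostInvariant.of_closure_eq_top hS fun g hg => ?_
    refine (hA.preimage (f := fun x => x * g) (mul_left_injective g).injOn).subset ?_
    rintro x ⟨hx, hxg⟩
    exact ⟨hxg, x, hx, (mulCayley_adj _ _ _).2 ⟨ne_of_mem_of_not_mem hx hxg, by simpa using hg⟩⟩

theorem isOneEnded_iff : IsOneEnded G ↔ Group.FG G ∧ Infinite G ∧
    ∀ A : Set G, AlmostInvariant A → A.Finite ∨ Aᶜ.Finite := by
  have hends : ∀ S : Finset G, Subgroup.closure (S : Set G) = ⊤ →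
      (cayleyNumEnds (S : Set G) = 1 ↔
        Infinite G ∧ ∀ A : Set G, AlmostInvariant A → A.Finite ∨ Aᶜ.Finite) := by
    intro S hS
    have : Fact (mulCayley (S : Set G)).Preconnected := ⟨preconnected_mulCayley hS⟩
    let _ : (mulCayley (S : Set G)).LocallyFinite := fun x =>
      (finite_neighborSet_mulCayley S.finite_toSet x).fintype
    simp only [cayleyNumEnds, encard_end_eq_one_iff,
      almostInvariant_iff_finite_outerBoundary hS S.finite_toSet]
  constructor
  · rintro ⟨S, hS, h⟩
    exact ⟨⟨S, hS⟩, (hends S hS).1 h⟩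
  · rintro ⟨⟨S, hS⟩, h⟩
    exact ⟨S, hS, (hends S hS).2 h⟩

theorem IsOneEnded.infinite (hG : IsOneEnded G) : Infinite G :=
  (isOneEnded_iff.1 hG).2.1

theorem exists_equivariant_retraction {N : Type*} [Group N] {f : N →* G}
    (hf : Function.Injective f) [f.range.FiniteIndex] :
    ∃ (p : G → N) (t : Set G), t.Finite ∧ (∀ n, p (f n) = n) ∧ (∀ n x, p (f n * x) = n * p x) ∧
      ∀ x, ∃ r ∈ t, f (p x) * r = x := by
  let E : N ≃* f.range := MonoidHom.ofInjective hf
  obtain ⟨t, ht, ht1⟩ := f.range.exists_isComplement_right 1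
  let p : G → N := fun x => E.symm (ht.equiv x).1
  have hp : ∀ n x, p (f n * x) = n * p x := by
    intro n x
    have hEn : E.symm ⟨f n, n, rfl⟩ = n := E.symm_apply_apply n
    simp only [p]
    rw [ht.equiv_mul_left ⟨f n, n, rfl⟩ x, map_mul, hEn]
  have hp1 : p 1 = 1 := by
    simp only [p]
    rw [ht.equiv_fst_eq_one_of_mem_of_one_mem f.range.one_mem ht1]
    exact map_one E.symm
  refine ⟨p, t, ht.finite_right, fun n => by simpa [hp1] using hp n 1, hp, fun x => ?_⟩
  have hfp : f (p x) = (ht.equiv x).1 := congrArg Subtype.val (E.apply_symm_apply (ht.equiv x).1)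
  exact ⟨(ht.equiv x).2, (ht.equiv x).2.2, by rw [hfp, ht.equiv_fst_mul_equiv_snd]⟩

theorem IsOneEnded.of_injective {N : Type v} [Group N] (hG : IsOneEnded G) (f : N →* G)
    (hf : Function.Injective f) [f.range.FiniteIndex] : IsOneEnded N := by
  have := hG.infinite
  obtain ⟨hfg, -, hA⟩ := isOneEnded_iff.1 hG
  let E : N ≃* f.range := MonoidHom.ofInjective hf
  obtain ⟨p, t, ht, hpf, hp, hpt⟩ := exists_equivariant_retraction hf
  refine isOneEnded_iff.2 ⟨Group.fg_of_surjective (f := (E.symm : f.range →* N)) E.symm.surjective,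
    not_finite_iff_infinite.1 fun _ => ?_, fun A hAi => ?_⟩
  · have : Finite f.range := Finite.of_equiv _ E.toEquiv
    have := Finite.of_equiv _ (Subgroup.groupEquivQuotientProdSubgroup (s := f.range)).symm
    exact not_finite G
  · have hpre : AlmostInvariant (p ⁻¹' A) := by
      intro g
      refine (ht.biUnion fun r _ => ((hAi (p (r * g))).image fun n => f n * r)).subset ?_
      rintro x ⟨hx, hxg⟩
      obtain ⟨r, hr, hrx⟩ := hpt x
      refine Set.mem_biUnion hr ⟨p x, ⟨hx, fun h => hxg ?_⟩, hrx⟩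
      rwa [← hp, ← mul_assoc, hrx] at h
    have hfinite : ∀ B : Set N, (p ⁻¹' B).Finite → B.Finite := fun B h =>
      (h.preimage hf.injOn).subset fun n hn => by simpa [hpf] using hn
    exact (hA _ hpre).imp (hfinite A) (hfinite Aᶜ)

end Ends

section Suspensions

variable {G : Type u} [Group G]

theorem finite_monoidHom_of_fg [hfg : Group.FG G] (Q : Type*) [Group Q] [Finite Q] :
    Finite (G →* Q) := by
  obtain ⟨S, hS⟩ := hfg
  refine Finite.of_injective (fun φ : G →* Q => fun s : (S : Set G) => φ s) fun φ φ' h => ?_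
  exact MonoidHom.eq_of_eqOn_dense hS fun s hs => congrFun h ⟨s, hs⟩

theorem exists_comp_pow_eq [Group.FG G] {Q : Type*} [Group Q] [Finite Q] (φ : G →* Q)
    (Φ : MulAut G) : ∃ k, 0 < k ∧ φ.comp (Φ ^ k).toMonoidHom = φ := by
  have := finite_monoidHom_of_fg (G := G) Q
  have hinj : Function.Injective fun ψ : G →* Q => ψ.comp Φ.toMonoidHom := fun _ _ h =>
    (MonoidHom.cancel_right Φ.surjective).1 h
  have hiterate : ∀ n : ℕ,
      (fun ψ : G →* Q => ψ.comp Φ.toMonoidHom)^[n] φ = φ.comp (Φ ^ n).toMonoidHom := by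
    intro n
    induction n with
    | zero => rfl
    | succ n ih => rw [Function.iterate_succ_apply', ih]; rfl
  obtain ⟨k, hk, hper⟩ := hinj.mem_periodicPts φ
  exact ⟨k, hk, (hiterate k).symm.trans hper⟩

theorem exists_pow_map_eq [Group.FG G] (K : Subgroup G) [K.FiniteIndex] (Φ : MulAut G) :
    ∃ k, 0 < k ∧ K.map (Φ ^ k).toMonoidHom = K := by
  obtain ⟨k, hk, h⟩ := exists_comp_pow_eq (MulAction.toPermHom G (G ⧸ K)) Φ
  have hcomap : K.comap (Φ ^ k).toMonoidHom = K := by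
    ext x
    have hx : ((Φ ^ k) x : G ⧸ K) = x := by
      simpa using congrArg (fun σ => σ ((1 : G) : G ⧸ K)) (DFunLike.congr_fun h x)
    have hmem : ∀ y : G, y ∈ K ↔ ((1 : G) : G ⧸ K) = y := fun y => by simp [QuotientGroup.eq]
    exact (hmem _).trans (hx ▸ (hmem x).symm)
  refine ⟨k, hk, ?_⟩
  conv_lhs => rw [← hcomap]
  exact Subgroup.map_comap_eq_self_of_surjective (Φ ^ k).surjective K

theorem map_zpow_apply_of_semiconj {N : Type*} [Group N] {f : N →* G} {Ψ : MulAut N}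
    {Θ : MulAut G} (h : ∀ x, f (Ψ x) = Θ (f x)) (n : ℤ) (x : N) :
    f ((Ψ ^ n) x) = (Θ ^ n) (f x) := by
  induction n generalizing x with
  | zero => rfl
  | succ n ih => rw [zpow_add_one, zpow_add_one, MulAut.mul_apply, MulAut.mul_apply, ih, h]
  | pred n ih =>
    rw [zpow_sub_one, zpow_sub_one, MulAut.mul_apply, MulAut.mul_apply, ih]
    congr 1
    rw [← MulAut.inv_apply_self G Θ (f _), ← h, MulAut.apply_inv_self]

variable {N : Type*} [Group N] {f : N →* G} {Ψ : MulAut N} {Φ : MulAut G} {k : ℕ}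

/-- The homomorphism of suspensions which extends `f` and sends the stable letter to `t ^ k`. -/
def suspensionMap (h : ∀ x, f (Ψ x) = (Φ ^ k) (f x)) : Suspension Ψ →* Suspension Φ :=
  SemidirectProduct.map f (powMonoidHom k) fun n => MonoidHom.ext fun x => by
    have hpow : (Φ ^ k) ^ n.toAdd = Φ ^ (n ^ k).toAdd := by
      rw [toAdd_pow, ← zpow_natCast, ← zpow_mul, nsmul_eq_mul]
    exact (map_zpow_apply_of_semiconj h n.toAdd x).trans (DFunLike.congr_fun hpow (f x))

theorem suspensionMap_inl (h : ∀ x, f (Ψ x) = (Φ ^ k) (f x)) (x : N) :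
    suspensionMap h (SemidirectProduct.inl x) = SemidirectProduct.inl (f x) :=
  SemidirectProduct.map_inl _ _ _ x

theorem suspensionMap_t (h : ∀ x, f (Ψ x) = (Φ ^ k) (f x)) :
    suspensionMap h (Suspension.t Ψ) = Suspension.t Φ ^ k :=
  (SemidirectProduct.map_inr _ _ _ _).trans (map_pow _ _ _)

theorem suspensionMap_injective (h : ∀ x, f (Ψ x) = (Φ ^ k) (f x)) (hf : Function.Injective f)
    (hk : k ≠ 0) : Function.Injective (suspensionMap h) := by
  intro a b hab
  refine SemidirectProduct.ext (hf (congrArg SemidirectProduct.left hab)) ?_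
  have hright : a.right ^ k = b.right ^ k := congrArg SemidirectProduct.right hab
  exact pow_left_injective hk hright

theorem relIndex_sup_of_normal (J N : Subgroup G) [N.Normal] :
    J.relIndex (N ⊔ J) = J.relIndex N := by
  let ι := Subgroup.quotientSubgroupOfEmbeddingOfLE J (le_sup_left : N ≤ N ⊔ J)
  refine (Nat.card_congr (Equiv.ofBijective ι ⟨ι.injective, fun q => ?_⟩)).symm
  obtain ⟨⟨x, hx⟩, rfl⟩ := QuotientGroup.mk_surjective q
  obtain ⟨n, hn, j, hj, rfl⟩ := Subgroup.mem_sup_of_normal_left.1 hx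
  refine ⟨QuotientGroup.mk ⟨n, hn⟩, QuotientGroup.eq.2 ?_⟩
  simpa [Subgroup.mem_subgroupOf] using hj

theorem finiteIndex_of_relIndex_ker_ne_zero {Q : Type*} [Group Q] (π : G →* Q) {J : Subgroup G}
    (hker : J.relIndex π.ker ≠ 0) [(J.map π).FiniteIndex] : J.FiniteIndex := by
  have hsup : (π.ker ⊔ J).index ≠ 0 := by
    rw [sup_comm, ← Subgroup.comap_map_eq, Subgroup.index_comap]
    exact Subgroup.FiniteIndex.index_ne_zero
  refine ⟨?_⟩
  rw [← Subgroup.relIndex_mul_index (le_sup_right : J ≤ π.ker ⊔ J), relIndex_sup_of_normal]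
  exact mul_ne_zero hker hsup

theorem finiteIndex_range_suspensionMap (h : ∀ x, f (Ψ x) = (Φ ^ k) (f x)) [f.range.FiniteIndex]
    (hk : k ≠ 0) : (suspensionMap h).range.FiniteIndex := by
  let π : Suspension Φ →* Multiplicative ℤ := SemidirectProduct.rightHom
  have hker : (suspensionMap h).range.relIndex π.ker ≠ 0 := by
    have hle : f.range ≤ (suspensionMap h).range.comap SemidirectProduct.inl := by
      rintro _ ⟨x, rfl⟩
      exact ⟨SemidirectProduct.inl x, suspensionMap_inl h x⟩
    rw [← SemidirectProduct.range_inl_eq_ker_rightHom, ← Subgroup.index_comap]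
    exact (Subgroup.finiteIndex_of_le hle).index_ne_zero
  have hmap : (suspensionMap h).range.map π = (powMonoidHom k).range := by
    rw [MonoidHom.map_range, suspensionMap, SemidirectProduct.rightHom_comp_map,
      MonoidHom.range_comp, MonoidHom.range_eq_top.2 SemidirectProduct.rightHom_surjective,
      MonoidHom.range_eq_map]
  have : ((suspensionMap h).range.map π).FiniteIndex :=
    hmap ▸ Subgroup.finiteIndex_range_powMonoidHom_of_fg _ hk
  exact finiteIndex_of_relIndex_ker_ne_zero π hker

theorem exists_suspension_embedding [Group.FG G] (K : Subgroup G) [K.FiniteIndex] (Φ : MulAut G) :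
    ∃ (k : ℕ) (Ψ : MulAut K), 0 < k ∧ (∀ x : K, ((Ψ x : K) : G) = (Φ ^ k) (x : G)) ∧
      ∃ j : Suspension Ψ →* Suspension Φ, Function.Injective j ∧
        (∀ x : K, j (SemidirectProduct.inl x) = SemidirectProduct.inl (x : G)) ∧
        j (Suspension.t Ψ) = Suspension.t Φ ^ k ∧ j.range.FiniteIndex := by
  obtain ⟨k, hk, hK⟩ := exists_pow_map_eq K Φ
  let Ψ : MulAut K := ((Φ ^ k).subgroupMap K).trans (MulEquiv.subgroupCongr hK)
  have hΨ : ∀ x : K, K.subtype (Ψ x) = (Φ ^ k) (K.subtype x) := fun x => rfl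
  have : K.subtype.range.FiniteIndex := by rwa [K.range_subtype]
  exact ⟨k, Ψ, hk, hΨ, suspensionMap hΨ, suspensionMap_injective hΨ K.subtype_injective hk.ne',
    suspensionMap_inl hΨ, suspensionMap_t hΨ, finiteIndex_range_suspensionMap hΨ hk.ne'⟩

end Suspensions

section FiniteIndex

open MulAction

variable {G : Type u} [Group G]

theorem subgroupComap_subtype_injective (K H : Subgroup G) :
    Function.Injective (K.subtype.subgroupComap H) := fun a b hab => by
  have : ((a : K) : G) = b := (Subtype.ext_iff.1 hab :)
  exact Subtype.ext (Subtype.ext this)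

theorem IsOneEnded.subgroupOf {H : Subgroup G} (hH : IsOneEnded H) (K : Subgroup G)
    [K.FiniteIndex] : IsOneEnded (H.subgroupOf K) := by
  let f : H.subgroupOf K →* H := K.subtype.subgroupComap H
  have hrange : f.range = K.subgroupOf H := by
    ext x
    exact ⟨fun ⟨y, hy⟩ => hy ▸ y.1.2, fun hx => ⟨⟨⟨x, hx⟩, x.2⟩, rfl⟩⟩
  have : f.range.FiniteIndex := hrange ▸ inferInstance
  exact hH.of_injective f (subgroupComap_subtype_injective K H)

theorem exists_finite_orbit_representatives {Y : Type*} [MulAction G Y] (K : Subgroup G)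
    [K.FiniteIndex] {F : Set Y} (hF : F.Finite) :
    ∃ F' : Set Y, F'.Finite ∧ ∀ y, (∃ g : G, g • y ∈ F) → ∃ g : K, g • y ∈ F' := by
  refine ⟨Set.image2 (fun (q : G ⧸ K) y => q.out⁻¹ • y) Set.univ F,
    Set.Finite.image2 _ Set.finite_univ hF, ?_⟩
  rintro y ⟨g, hg⟩
  have hmem : (g : G ⧸ K).out⁻¹ * g ∈ K := QuotientGroup.eq.1 (QuotientGroup.out_eq' _)
  exact ⟨⟨_, hmem⟩, _, Set.mem_univ _, _, hg, (mul_smul _ _ _).symm⟩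

variable {V : Type v} [MulAction G V] {T : SimpleGraph V}

theorem IsStallingsDunwoody.of_finiteIndex (hT : IsStallingsDunwoody G T) (K : Subgroup G)
    [K.FiniteIndex] : IsStallingsDunwoody K T where
  isTree := hT.isTree
  smul_adj g := hT.smul_adj g
  no_inversion g := hT.no_inversion g
  finite_vertex_orbits := by
    obtain ⟨F, hF, h⟩ := hT.finite_vertex_orbits
    obtain ⟨F', hF', h'⟩ := exists_finite_orbit_representatives K hF
    exact ⟨F', hF', fun v => h' v (h v)⟩
  finite_edge_orbits := by
    obtain ⟨F, hF, h⟩ := hT.finite_edge_orbits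
    obtain ⟨F', hF', h'⟩ := exists_finite_orbit_representatives K hF
    exact ⟨F', hF', fun v w hvw => h' (v, w) (h v w hvw)⟩
  finite_edge_group v w hvw := by
    have := hT.finite_edge_group v w hvw
    exact Finite.of_injective _
      (subgroupComap_subtype_injective K (stabilizer G v ⊓ stabilizer G w))
  vertex_group v := by
    refine (hT.vertex_group v).imp (fun h => ?_) fun h => h.subgroupOf K
    have : Finite (stabilizer G v) := h
    exact Finite.of_injective _ (subgroupComap_subtype_injective K (stabilizer G v))

theorem IsStallingsDunwoody.finite_edge_quotient (hT : IsStallingsDunwoody G T)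
    {O : SubMulAction G (V × V)} (hO : IsOrientation T O) : Finite (orbitRel.Quotient G O) := by
  obtain ⟨F, hF, h⟩ := hT.finite_edge_orbits
  exact finite_orbitRel_quotient (hF.preimage Subtype.val_injective.injOn)
    fun d => h _ _ (hO.adj d d.2)

theorem IsStallingsDunwoody.isFreeProductOneEndedFree (hT : IsStallingsDunwoody G T)
    (hfree : ∀ v w, T.Adj v w → ∀ g : G, g • v = v → g • w = w → g = 1)
    (hV : ∀ v : V, Finite (stabilizer G v) → stabilizer G v = ⊥) :
    IsFreeProductOneEndedFree G := by
  obtain ⟨O, hO⟩ := exists_isOrientation hT.smul_adj hT.no_inversion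
  have := hT.finite_vertex_quotient
  have := hT.finite_edge_quotient hO
  obtain ⟨S, E, hSE⟩ := hO.exists_isFundamentalTree hT.isTree.connected
  exact isFreeProductOneEndedFree_of_bijective _ _
    (fun q => (hT.vertex_group _).resolve_left fun h => q.2 (hV _ h))
    (hSE.bijective_lift hO hT.isTree hfree)

theorem IsStallingsDunwoody.exists_finiteIndex_isFreeProductOneEndedFree
    (hT : IsStallingsDunwoody G T)
    (hsep : ∀ v : V, IsOneEnded (stabilizer G v) →
      ∃ N : Subgroup (stabilizer G v), N.Normal ∧ N.FiniteIndex ∧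
        ∀ w : V, T.Adj v w → N ⊓ (stabilizer G w).subgroupOf (stabilizer G v) = ⊥) :
    ∃ K : Subgroup G, K.FiniteIndex ∧ IsFreeProductOneEndedFree K := by
  obtain ⟨K, hK, hedge, hvertex⟩ := hT.exists_finiteIndex_free_on_edges hsep
  refine ⟨K, hK, (hT.of_finiteIndex K).isFreeProductOneEndedFree
    (fun v w h g hv hw => Subtype.ext (hedge v w h g g.2 hv hw)) fun v hfin => ?_⟩
  rcases hT.vertex_group v with hGv | hGv
  · exact (Subgroup.eq_bot_iff_forall _).2 fun g hg => Subtype.ext (hvertex v hGv g g.2 hg)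
  · have : Infinite (stabilizer K v) := (hGv.subgroupOf K).infinite
    exact (not_finite (stabilizer K v)).elim

end FiniteIndex

theorem mainTheorem11_general (G : Type u) [Group G] (hfg : Group.FG G)
    (V : Type v) [MulAction G V] (T : SimpleGraph V) (hT : IsStallingsDunwoody G T)
    (hsep : ∀ v : V, IsOneEnded (MulAction.stabilizer G v) →
      ∃ N : Subgroup (MulAction.stabilizer G v), N.Normal ∧ N.FiniteIndex ∧
        ∀ w : V, T.Adj v w →
          N ⊓ (MulAction.stabilizer G w).subgroupOf (MulAction.stabilizer G v) = ⊥) :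
    ∃ K : Subgroup G, K.FiniteIndex ∧ IsFreeProductOneEndedFree K ∧
      ∀ Φ : MulAut G, ∃ (k : ℕ) (Ψ : MulAut K), 0 < k ∧
        (∀ x : K, ((Ψ x : K) : G) = (Φ ^ k) (x : G)) ∧
        ∃ j : Suspension Ψ →* Suspension Φ, Function.Injective j ∧
          (∀ x : K, j (SemidirectProduct.inl x) = SemidirectProduct.inl (x : G)) ∧
          j (Suspension.t Ψ) = Suspension.t Φ ^ k ∧
          j.range.FiniteIndex := by
  obtain ⟨K, hK, hfree⟩ := hT.exists_finiteIndex_isFreeProductOneEndedFree hsep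
  exact ⟨K, hK, hfree, exists_suspension_embedding K⟩

theorem mainTheorem11 (G : Type u) [Group G] (hfg : Group.FG G) (hinf : IsInfinitelyEnded G)
    (hacc : IsAccessible G)
    (V : Type v) [MulAction G V] (T : SimpleGraph V) (hT : IsStallingsDunwoody G T)
    (hsep : ∀ v : V, IsOneEnded (MulAction.stabilizer G v) →
      ∃ N : Subgroup (MulAction.stabilizer G v), N.Normal ∧ N.FiniteIndex ∧
        ∀ w : V, T.Adj v w →
          N ⊓ (MulAction.stabilizer G w).subgroupOf (MulAction.stabilizer G v) = ⊥) :
    ∃ K : Subgroup G, K.FiniteIndex ∧ IsFreeProductOneEndedFree K ∧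
      ∀ Φ : MulAut G, ∃ (k : ℕ) (Ψ : MulAut K), 0 < k ∧
        (∀ x : K, ((Ψ x : K) : G) = (Φ ^ k) (x : G)) ∧
        ∃ j : Suspension Ψ →* Suspension Φ, Function.Injective j ∧
          (∀ x : K, j (SemidirectProduct.inl x) = SemidirectProduct.inl (x : G)) ∧
          j (Suspension.t Ψ) = Suspension.t Φ ^ k ∧
          j.range.FiniteIndex :=
  mainTheorem11_general G hfg V T hT hsep
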